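/- Let $N\ge 1$ be a fixed integer. For a real number $z$ let $P=P(z)$ be the product of all primes $p\le z$. Put $P_n=P/\gcd(P,n)$. Let $W_P(N)$ be the set of integers $1\le n\le P$ such that $(N-n)(N+n)$ is coprime to $P$, and let $W_P^1(N)$ be the set of those $n\in W_P(N)$ with $\gcd(P_{6N},n)=1$. Define the densities $\omega_P(N)=|W_P(N)|/P$ and $\omega_P^1(N)=|W_P^1(N)|/P$. Let $\gamma$ be the Euler–Mascheroni constant, $C_1=e^{\gamma}$, and, with $p$ always denoting a prime, $$C_2=\prod_{p\ge 3}\frac{(p-2)p}{(p-1)^2},\qquad d_N=\prod_{p\mid N,\ p\ge 3}\frac{p-1}{p-2},$$ $$C_3=\prod_{p\ge 5}\frac{(p-3)p^2}{(p-1)^3},\qquad d'_N=\varepsilon_N\prod_{p\mid N,\ p\ge 5}\frac{p-1}{p-3},$$ where $\varepsilon_N=2$ if $3\mid N$ and $\varepsilon_N=1$ otherwise. The infinite products $C_2$ and $C_3$ converge to positive limits, and the following hold. (1) For every real $z\ge 2$, $$\omega_P(N)=2\prod_{3\le p\le z}\frac{(p-2)p}{(p-1)^2}\ \prod_{p\mid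 N,\ 3\le p\le z}\frac{p-1}{p-2}\ \prod_{2\le p\le z}\Bigl(1-\frac1p\Bigr)^2,$$ and, as $z\to\infty$, $$\omega_P(N)\sim\frac{2C_2d_N}{C_1^2\log^2 z}.$$ (2) For every real $z\ge 3$, $$\omega_P^1(N)=\frac92\prod_{5\le p\le z}\frac{(p-3)p^2}{(p-1)^3}\cdot\varepsilon_N\prod_{p\mid N,\ 5\le p\le z}\frac{p-1}{p-3}\ \prod_{2\le p\le z}\Bigl(1-\frac1p\Bigr)^3,$$ and, as $z\to\infty$, $$\omega_P^1(N)\sim\frac{9C_3d'_N}{2C_1^3\log^3 z}.$$ -/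

import Mathlib

open scoped Asymptotics

noncomputable section

namespace GoldbachDensity

/-- `P_n = P / gcd(P, n)`. -/
def cofactor (P n : ℕ) : ℕ := P / Nat.gcd P n

/-- `W_P(N)`: the integers `1 ≤ n ≤ P` such that `(N - n)(N + n)` is coprime to `P`.
The product is taken in `ℤ`. -/
def W (P N : ℕ) : Finset ℕ :=
  (Finset.Icc 1 P).filter fun n => Int.gcd (((N : ℤ) - n) * ((N : ℤ) + n)) (P : ℤ) = 1

/-- `W_P^d(N)`: the `n ∈ W_P(N)` such that `gcd(P_{6N}, n) = d`. -/
def Wd (d P N : ℕ) : Finset ℕ :=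
  (W P N).filter fun n => Nat.gcd (cofactor P (6 * N)) n = d

/-- The density `ω_P(N) = |W_P(N)| / P`. -/
def omega (P N : ℕ) : ℝ := ((W P N).card : ℝ) / P

/-- The density `ω_P^d(N) = |W_P^d(N)| / P`. -/
def omegaD (d P N : ℕ) : ℝ := ((Wd d P N).card : ℝ) / P

/-- The product of all primes `p ≤ z`. -/
def primeProd (z : ℝ) : ℕ := primorial ⌊z⌋₊

/-- The primes `p` with `a ≤ p ≤ z`. -/
def primesIn (a : ℕ) (z : ℝ) : Finset ℕ := (Finset.Icc a ⌊z⌋₊).filter Nat.Prime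

/-- The factor `(p - 2) p / (p - 1)²`. -/
def factor2 (p : ℕ) : ℝ := ((p : ℝ) - 2) * p / ((p : ℝ) - 1) ^ 2

/-- The factor `(p - 3) p² / (p - 1)³`. -/
def factor3 (p : ℕ) : ℝ := ((p : ℝ) - 3) * (p : ℝ) ^ 2 / ((p : ℝ) - 1) ^ 3

/-- `C_1 = e^γ`. -/
def C₁ : ℝ := Real.exp Real.eulerMascheroniConstant

/-- The twin prime constant, the infinite product of `factor2` over all primes `p ≥ 3`. -/
def C₂ : ℝ := ∏' p : {p : ℕ // p.Prime ∧ 3 ≤ p}, factor2 p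

/-- The infinite product of `factor3` over all primes `p ≥ 5`. -/
def C₃ : ℝ := ∏' p : {p : ℕ // p.Prime ∧ 5 ≤ p}, factor3 p

/-- `d_N`, the product of `(p - 1) / (p - 2)` over the primes `p ≥ 3` dividing `N`. -/
def dN (N : ℕ) : ℝ :=
  ∏ p ∈ N.primeFactors.filter (fun p => 3 ≤ p), ((p : ℝ) - 1) / ((p : ℝ) - 2)

/-- The factor `2` if `3 ∣ N`, and the empty product otherwise. -/
def threeFactor (N : ℕ) : ℝ := if 3 ∣ N then 2 else 1

/-- `d'_N`, the product of `(p - 1) / (p - 3)` over the primes `p ≥ 5` dividing `N`, with an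
extra factor `2` if `3 ∣ N`. -/
def dN' (N : ℕ) : ℝ :=
  threeFactor N *
    ∏ p ∈ N.primeFactors.filter (fun p => 5 ≤ p), ((p : ℝ) - 1) / ((p : ℝ) - 3)

end GoldbachDensity

end

/-! Both conditions depend only on residues modulo the primes `p ≤ z`, so by the Chinese remainder
theorem each density is the product over `p` of the proportion of admissible residues
(`omega_primeProd`, `omegaD_one_primeProd`). For `W` the residues `N` and `-N` are excluded: one
class if `p = 2` or `p ∣ N`, two otherwise. For `Wd 1` the class `0` is excluded as well when `p ∤
6N`. Dividing each proportion by `(1 - 1/p)²`, respectively `(1 - 1/p)³`, gives the exact formulas.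

For the asymptotics, the normalised factors are `1 + O(1/p²)`, so their products converge, and the
products over `p ∣ N` are constant once `z ≥ N`. What remains is Mertens' third theorem, `∏ (1 -
1/p) ~ 1 / (e^γ log z)`.

Its proof has two stages. Mertens' first and second theorems give `mertensSum n = log (log n) + c +
o(1)` for some `c`. To find `c`, `mertensSum ⌊e^u⌋` is compared with the harmonic number of `⌊u⌋`,
which is `log u + γ + o(1)`. The average of the difference at `u = t/s` against `e^{-t}` tends to `c
- γ` as `s → 0⁺`. It also equals a prime sum plus `log (1 - e^{-s})`, which tends to `0` by the
Euler product and `s ζ(1 + s) → 1`. Hence `c = γ`. -/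

namespace GoldbachDensity

/-! ### Mertens' first and second theorems, and the third up to its constant. -/

section Mertens

open Finset Filter Topology Real

lemma log_factorial_eq_sum_primesLE (n : ℕ) :
    log (n.factorial : ℝ) =
      ∑ p ∈ Nat.primesLE n, (padicValNat p n.factorial : ℝ) * log p := by
  rw [log_nat_eq_sum_factorization, Finsupp.sum_of_support_subset (s := Nat.primesLE n)]
  · refine sum_congr rfl fun p hp => ?_
    rw [Nat.factorization_def _ (Nat.prime_of_mem_primesLE hp)]
  · intro p hp
    rw [Nat.support_factorization, Nat.mem_primeFactors] at hp
    exact Nat.mem_primesLE.2 ⟨(hp.1.dvd_factorial).1 hp.2.1, hp.1⟩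
  · simp

lemma padicValNat_factorial_lower (n : ℕ) {p : ℕ} (hp : p.Prime) :
    (n : ℝ) / p - 1 ≤ padicValNat p n.factorial := by
  have := Fact.mk hp
  have h1 : n / p ≤ padicValNat p n.factorial := by
    -- The bound `+ 2` instead of `+ 1` keeps `i = 1` in the range of summation even when `Nat.log p
    -- n = 0`.
    rw [padicValNat_factorial (b := Nat.log p n + 2) (by lia)]
    calc n / p = n / p ^ 1 := by rw [pow_one]
      _ ≤ _ := single_le_sum (f := fun i => n / p ^ i) (fun _ _ => Nat.zero_le _) (by simp)
  have h2 : (n : ℝ) / p < (n / p : ℕ) + 1 := by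
    rw [← Nat.floor_div_eq_div (K := ℝ)]
    exact Nat.lt_floor_add_one _
  have h3 : ((n / p : ℕ) : ℝ) ≤ padicValNat p n.factorial := by exact_mod_cast h1
  linarith

lemma padicValNat_factorial_upper (n : ℕ) {p : ℕ} (hp : p.Prime) :
    (padicValNat p n.factorial : ℝ) ≤ n / ((p : ℝ) - 1) := by
  have := Fact.mk hp
  have h1 : (p - 1) * padicValNat p n.factorial ≤ n := by
    -- Legendre's formula: the left side is `n` minus the sum of its digits in base `p`.
    rw [sub_one_mul_padicValNat_factorial]
    exact Nat.sub_le _ _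
  have h2 : (1 : ℝ) < p := by exact_mod_cast hp.one_lt
  rw [le_div_iff₀ (by linarith)]
  have h3 : (((p - 1) * padicValNat p n.factorial : ℕ) : ℝ) ≤ n := by exact_mod_cast h1
  rw [Nat.cast_mul, Nat.cast_sub hp.one_le, Nat.cast_one] at h3
  linarith

lemma mul_log_sub_le_log_factorial (n : ℕ) :
    (n : ℝ) * log n - n ≤ log (n.factorial : ℝ) := by
  rcases Nat.eq_zero_or_pos n with rfl | hn
  · simp
  have hn' : (0 : ℝ) < n := by exact_mod_cast hn
  have h := pow_div_factorial_le_exp (x := (n : ℝ)) hn'.le n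
  have hf : (0 : ℝ) < n.factorial := by exact_mod_cast n.factorial_pos
  have h2 := log_le_log (by positivity) h
  rw [log_exp, log_div (by positivity) hf.ne', log_pow] at h2
  linarith

lemma log_factorial_le_mul_log (n : ℕ) : log (n.factorial : ℝ) ≤ n * log n := by
  rw [← log_pow]
  refine log_le_log (by exact_mod_cast n.factorial_pos) ?_
  exact_mod_cast n.factorial_le_pow

/-- Follows from `log n ≤ 2 √n` and `n - 1 ≥ n / 2`. It makes the cost of replacing `log p / (p -
1)` by `log p / p` summable. -/
lemma log_div_mul_sub_one_le {n : ℕ} (hn : 2 ≤ n) :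
    log n / (n * ((n : ℝ) - 1)) ≤ 4 * (n : ℝ) ^ (-(3 / 2) : ℝ) := by
  have hn' : (2 : ℝ) ≤ n := by exact_mod_cast hn
  have h1 : log n ≤ (n : ℝ) ^ (1 / 2 : ℝ) / (1 / 2) :=
    log_le_rpow_div (by linarith) (by norm_num)
  have h2 : (n : ℝ) ^ (-(3 / 2) : ℝ) * (n * n) = (n : ℝ) ^ (1 / 2 : ℝ) := by
    rw [← sq, ← rpow_natCast, ← rpow_add (by linarith)]
    norm_num
  have h3 : 0 < (n : ℝ) ^ (-(3 / 2) : ℝ) := rpow_pos_of_pos (by linarith) _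
  rw [div_le_iff₀ (mul_pos (by linarith) (by linarith))]
  nlinarith [mul_nonneg h3.le (mul_nonneg (by linarith : (0 : ℝ) ≤ n)
    (by linarith : (0 : ℝ) ≤ (n : ℝ) - 2))]

/-- **Mertens' first theorem**. -/
lemma exists_abs_sum_log_div_sub_log_le :
    ∃ C : ℝ, ∀ n : ℕ, 1 ≤ n → |∑ p ∈ Nat.primesLE n, log p / p - log n| ≤ C := by
  have hs : Summable fun k : ℕ => 4 * (k : ℝ) ^ (-(3 / 2) : ℝ) :=
    (Real.summable_nat_rpow.2 (by norm_num)).mul_left 4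
  refine ⟨log 4 + 1 + ∑' k : ℕ, 4 * (k : ℝ) ^ (-(3 / 2) : ℝ), fun n hn => ?_⟩
  have hn' : (0 : ℝ) < n := by exact_mod_cast hn
  have hT : 0 ≤ ∑' k : ℕ, 4 * (k : ℝ) ^ (-(3 / 2) : ℝ) := tsum_nonneg fun k => by positivity
  have hlog4 : 0 ≤ log 4 := log_nonneg (by norm_num)
  have hlogp : ∀ p : ℕ, 0 ≤ log (p : ℝ) := fun p => log_natCast_nonneg p
  rw [abs_le]
  constructor
  · have h1 : log (n.factorial : ℝ) ≤ n * ∑ p ∈ Nat.primesLE n, log p / ((p : ℝ) - 1) := by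
      rw [log_factorial_eq_sum_primesLE, mul_sum]
      refine sum_le_sum fun p hp => ?_
      have := mul_le_mul_of_nonneg_right
        (padicValNat_factorial_upper n (Nat.prime_of_mem_primesLE hp)) (hlogp p)
      calc _ ≤ _ := this
        _ = _ := by ring
    have h2 : log n - 1 ≤ ∑ p ∈ Nat.primesLE n, log p / ((p : ℝ) - 1) := by
      have := (mul_log_sub_le_log_factorial n).trans h1
      refine le_of_mul_le_mul_left ?_ hn'
      linarith
    have h3 : ∑ p ∈ Nat.primesLE n, log p / ((p : ℝ) - 1) - ∑ p ∈ Nat.primesLE n, log p / p ≤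
        ∑' k : ℕ, 4 * (k : ℝ) ^ (-(3 / 2) : ℝ) := by
      rw [← sum_sub_distrib]
      refine le_trans (sum_le_sum fun p hp => ?_)
        (hs.sum_le_tsum (Nat.primesLE n) fun k _ => by positivity)
      have hp2 := Nat.two_le_of_mem_primesLE hp
      have hp2' : (2 : ℝ) ≤ p := by exact_mod_cast hp2
      have h0 : (p : ℝ) - 1 ≠ 0 := by linarith
      have h0' : (p : ℝ) ≠ 0 := by linarith
      refine le_trans (le_of_eq ?_) (log_div_mul_sub_one_le hp2)
      field_simp
      ring
    linarith
  · have h1 : n * ∑ p ∈ Nat.primesLE n, log p / p - log 4 * n ≤ log (n.factorial : ℝ) := by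
      -- The errors `-1` in the lower bounds for the valuations add up to `θ(n)`, which is `O(n)` by
      -- Chebyshev.
      have hθ := Chebyshev.theta_le_log4_mul_x (x := n) hn'.le
      rw [Chebyshev.theta_eq_sum_primesLE_log] at hθ
      have : ∑ p ∈ Nat.primesLE n, ((n : ℝ) / p - 1) * log p ≤ log (n.factorial : ℝ) := by
        rw [log_factorial_eq_sum_primesLE]
        exact sum_le_sum fun p hp => mul_le_mul_of_nonneg_right
          (padicValNat_factorial_lower n (Nat.prime_of_mem_primesLE hp)) (hlogp p)
      have h4 : ∑ p ∈ Nat.primesLE n, ((n : ℝ) / p - 1) * log p =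
          n * ∑ p ∈ Nat.primesLE n, log p / p - ∑ p ∈ Nat.primesLE n, log p := by
        rw [mul_sum, ← sum_sub_distrib]
        exact sum_congr rfl fun p _ => by ring
      linarith
    have h2 : ∑ p ∈ Nat.primesLE n, log p / p ≤ log n + log 4 := by
      have := h1.trans (log_factorial_le_mul_log n)
      refine le_of_mul_le_mul_left ?_ hn'
      linarith
    linarith

/-- Indexing from `2` keeps `log (i + 2)` positive, so that it can be a denominator. -/
lemma sum_primesLE_succ (f : ℕ → ℝ) (n : ℕ) :
    ∑ p ∈ Nat.primesLE (n + 1), f p =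
      ∑ i ∈ range n, if (i + 2).Prime then f (i + 2) else 0 := by
  rw [Nat.primesLE_eq_filter_range, sum_filter, sum_range_succ', sum_range_succ']
  simp [Nat.not_prime_zero, Nat.not_prime_one]

lemma one_sub_add_log_bounds {r : ℝ} (hr : 0 < r) :
    1 - r + log r ≤ 0 ∧ -((1 - r) ^ 2 / r) ≤ 1 - r + log r := by
  refine ⟨by linarith [log_le_sub_one_of_pos hr], ?_⟩
  have h := one_sub_inv_le_log_of_pos hr
  have : -((1 - r) ^ 2 / r) = 1 - r + (1 - r⁻¹) := by field_simp; ring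
  linarith

/-- `∑ (1 - log (k - 1) / log k)` is `log log` up to a convergent error. -/
lemma exists_tendsto_sum_sub_log_log : ∃ c : ℝ, Tendsto (fun n : ℕ =>
    ∑ i ∈ range n, (1 - log ((i : ℝ) + 1) / log ((i : ℝ) + 2)) - log (log ((n : ℝ) + 1)))
    atTop (𝓝 c) := by
  -- `d i` is the summand of index `i + 1` minus the matching increment of `log log`. It has the
  -- form `1 - r + log r` with `r` near `1`, hence is quadratically small.
  set d : ℕ → ℝ := fun i => 1 - log ((i : ℝ) + 2) / log ((i : ℝ) + 3) +
    log (log ((i : ℝ) + 2) / log ((i : ℝ) + 3)) with hd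
  have hl2 : 0 < log 2 := log_pos (by norm_num)
  have hlog2 : ∀ i : ℕ, log 2 ≤ log ((i : ℝ) + 2) := fun i =>
    log_le_log (by norm_num) (by linarith [(Nat.cast_nonneg i : (0 : ℝ) ≤ i)])
  have hlog3 : ∀ i : ℕ, log ((i : ℝ) + 2) ≤ log ((i : ℝ) + 3) := fun i =>
    log_le_log (by positivity) (by linarith)
  have hdiff : ∀ i : ℕ, log ((i : ℝ) + 3) - log ((i : ℝ) + 2) ≤ 1 / ((i : ℝ) + 1) := fun i => by
    rw [← log_div (by positivity) (by positivity)]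
    refine (log_le_sub_one_of_pos (by positivity)).trans ?_
    have : ((i : ℝ) + 3) / (i + 2) - 1 = 1 / ((i : ℝ) + 2) := by field_simp; ring
    rw [this]
    exact one_div_le_one_div_of_le (by positivity) (by linarith)
  have hsd : Summable d := by
    have hs : Summable fun i : ℕ => 1 / (log 2) ^ 2 * (1 / ((i + 1 : ℕ) : ℝ) ^ 2) :=
      ((summable_nat_add_iff 1).2 (Real.summable_one_div_nat_pow.2 one_lt_two)).mul_left _
    refine hs.of_norm_bounded fun i => ?_
    have h2 := hlog2 i
    have h3 := hlog3 i
    have h4 := hdiff i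
    have hr : 0 < log ((i : ℝ) + 2) / log ((i : ℝ) + 3) := div_pos (by linarith) (by linarith)
    obtain ⟨hb1, hb2⟩ := one_sub_add_log_bounds hr
    rw [Real.norm_eq_abs, abs_of_nonpos hb1]
    refine (neg_le.1 hb2).trans ?_
    set a := log ((i : ℝ) + 2)
    set b := log ((i : ℝ) + 3)
    have ha : 0 < a := by linarith
    have hb : 0 < b := by linarith
    have : (1 - a / b) ^ 2 / (a / b) = (b - a) ^ 2 / (a * b) := by field_simp
    rw [this, div_mul_div_comm, one_mul]
    have e1 : (b - a) ^ 2 ≤ (1 / ((i : ℝ) + 1)) ^ 2 := pow_le_pow_left₀ (by linarith) h4 2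
    have e2 : (log 2) ^ 2 ≤ a * b := by nlinarith
    calc (b - a) ^ 2 / (a * b) ≤ (1 / ((i : ℝ) + 1)) ^ 2 / (log 2) ^ 2 :=
          div_le_div₀ (by positivity) e1 (by positivity) e2
      _ = _ := by push_cast; field_simp
  -- `1 - log (log 2)` is the value at `n = 1`, where the telescoping starts.
  refine ⟨1 - log (log 2) + ∑' i, d i, ?_⟩
  rw [← tendsto_add_atTop_iff_nat 1]
  refine (hsd.hasSum.tendsto_sum_nat.const_add (1 - log (log 2))).congr fun n => ?_
  induction n with
  | zero => norm_num
  | succ n ih =>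
    rw [sum_range_succ, ← add_assoc, ih, sum_range_succ _ (n + 1)]
    have h2 := hlog2 n
    have h3 := hlog3 n
    simp only [hd]
    rw [log_div (by linarith) (by linarith)]
    push_cast
    rw [show (n : ℝ) + 1 + 1 = n + 2 by ring, show (n : ℝ) + 1 + 2 = n + 3 by ring,
      show (n : ℝ) + 2 + 1 = n + 3 by ring]
    ring

/-- **Mertens' second theorem**, without the value of the constant. -/
lemma exists_tendsto_sum_inv_sub_log_log : ∃ c : ℝ, Tendsto (fun n : ℕ =>
    ∑ p ∈ Nat.primesLE n, 1 / (p : ℝ) - log (log n)) atTop (𝓝 c) := by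
  obtain ⟨C, hC⟩ := exists_abs_sum_log_div_sub_log_le
  -- Dirichlet's test: by Mertens' first theorem the partial sums of `z` are bounded, and the
  -- weights `1 / log (i + 2)` decrease to `0`. The weighted terms are `1/p` at primes minus the
  -- summands of `exists_tendsto_sum_sub_log_log`.
  set z : ℕ → ℝ := fun i => (if (i + 2).Prime then log ((i + 2 : ℕ) : ℝ) / (i + 2 : ℕ) else 0) -
    (log ((i : ℝ) + 2) - log ((i : ℝ) + 1)) with hz
  have hlogpos : ∀ i : ℕ, 0 < log ((i : ℝ) + 2) := fun i =>
    log_pos (by linarith [(Nat.cast_nonneg i : (0 : ℝ) ≤ i)])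
  have hsum : ∀ n, ‖∑ i ∈ range n, z i‖ ≤ C := fun n => by
    have h := hC (n + 1) (by lia)
    rw [sum_primesLE_succ (fun p => log p / p)] at h
    have ht : ∀ n : ℕ, ∑ i ∈ range n, (log ((i : ℝ) + 2) - log ((i : ℝ) + 1)) =
        log ((n + 1 : ℕ) : ℝ) := fun n => by
      have := sum_range_sub (fun i : ℕ => log ((i : ℝ) + 1)) n
      simp only [Nat.cast_add, Nat.cast_one, Nat.cast_zero, zero_add, log_one, sub_zero] at this
      push_cast
      rw [← this]
      exact sum_congr rfl fun i _ => by rw [add_assoc]; norm_num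
    rw [hz, sum_sub_distrib, ht]
    exact h
  have hanti : Antitone fun i : ℕ => 1 / log ((i : ℝ) + 2) := fun i j hij => by
    have hij' : (i : ℝ) ≤ j := by exact_mod_cast hij
    exact one_div_le_one_div_of_le (hlogpos i) (log_le_log (by positivity) (by linarith))
  have hzero : Tendsto (fun i : ℕ => 1 / log ((i : ℝ) + 2)) atTop (𝓝 0) := by
    simp only [one_div]
    exact (tendsto_log_atTop.comp
      (tendsto_atTop_add_const_right _ 2 tendsto_natCast_atTop_atTop)).inv_tendsto_atTop
  obtain ⟨a, ha⟩ := cauchySeq_tendsto_of_complete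
    (hanti.cauchySeq_series_mul_of_tendsto_zero_of_bounded hzero hsum)
  obtain ⟨b, hb⟩ := exists_tendsto_sum_sub_log_log
  refine ⟨a + b, ?_⟩
  rw [← tendsto_add_atTop_iff_nat 1]
  refine (ha.add hb).congr fun n => ?_
  rw [sum_primesLE_succ (fun p => 1 / (p : ℝ)), ← add_sub_assoc, ← sum_add_distrib]
  push_cast
  congr 1
  refine sum_congr rfl fun i _ => ?_
  have := (hlogpos i).ne'
  simp only [hz, smul_eq_mul]
  split_ifs
  · push_cast
    field_simp
    ring
  · field_simp
    ring

lemma neg_log_one_sub_sub_bounds {x : ℝ} (h1 : x ≤ 1 / 2) :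
    0 ≤ -log (1 - x) - x ∧ -log (1 - x) - x ≤ 2 * x ^ 2 := by
  have h := log_le_sub_one_of_pos (x := 1 - x) (by linarith)
  have h' := one_sub_inv_le_log_of_pos (x := 1 - x) (by linarith)
  refine ⟨by linarith, ?_⟩
  have : (1 - x)⁻¹ - 1 - x = x ^ 2 * (1 - x)⁻¹ := by
    have : 1 - x ≠ 0 := by linarith
    field_simp
    ring
  have h2 : (1 - x)⁻¹ ≤ 2 := by
    rw [inv_le_comm₀ (by linarith) (by norm_num)]
    linarith
  nlinarith [mul_le_mul_of_nonneg_left h2 (sq_nonneg x)]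

/-- The negative logarithm of the Mertens product. -/
noncomputable def mertensSum (n : ℕ) : ℝ := ∑ p ∈ Nat.primesLE n, -log (1 - 1 / (p : ℝ))

lemma inv_prime_bounds {p : ℕ} (hp : 2 ≤ p) : 0 ≤ 1 / (p : ℝ) ∧ 1 / (p : ℝ) ≤ 1 / 2 :=
  ⟨by positivity, one_div_le_one_div_of_le two_pos (by exact_mod_cast hp)⟩

lemma exists_tendsto_mertensSum_sub_log_log : ∃ c : ℝ, Tendsto (fun n : ℕ =>
    mertensSum n - log (log n)) atTop (𝓝 c) := by
  obtain ⟨a, ha⟩ := exists_tendsto_sum_inv_sub_log_log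
  set g : ℕ → ℝ := fun i =>
    if (i + 2).Prime then -log (1 - 1 / ((i + 2 : ℕ) : ℝ)) - 1 / ((i + 2 : ℕ) : ℝ) else 0 with hg
  have hs : Summable g := by
    have hs' : Summable fun i : ℕ => 2 * (1 / ((i + 2 : ℕ) : ℝ) ^ 2) :=
      ((summable_nat_add_iff 2).2 (Real.summable_one_div_nat_pow.2 one_lt_two)).mul_left _
    refine hs'.of_norm_bounded fun i => ?_
    have hb := inv_prime_bounds (p := i + 2) (by lia)
    have h := neg_log_one_sub_sub_bounds hb.2
    simp only [hg]
    split_ifs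
    · rw [Real.norm_eq_abs, abs_of_nonneg h.1]
      refine h.2.trans (le_of_eq ?_)
      rw [div_pow, one_pow]
    · simp only [norm_zero]
      positivity
  refine ⟨∑' i, g i + a, ?_⟩
  rw [← tendsto_add_atTop_iff_nat 1] at ha ⊢
  refine (hs.hasSum.tendsto_sum_nat.add ha).congr fun n => ?_
  rw [← add_sub_assoc, mertensSum, hg,
    ← sum_primesLE_succ (fun p => -log (1 - 1 / (p : ℝ)) - 1 / (p : ℝ)), ← sum_add_distrib]
  congr 1
  exact sum_congr rfl fun p _ => by ring

end Mertens

/-! ### Identification of the Mertens constant as `γ`. -/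

section Mertens

open Finset Filter Topology Real MeasureTheory

/-- The Laplace transform of a step function with jumps `a n` at `l n / s`. -/
lemma hasSum_mul_exp_neg {a l : ℕ → ℝ} (hl : ∀ n, 0 ≤ l n)
    (hs : Summable fun n => a n * exp (-l n)) :
    HasSum (fun n => a n * exp (-l n))
      (∫ t in Set.Ioi (0 : ℝ), ∑' n, if l n ≤ t then a n * exp (-t) else 0) := by
  set F : ℕ → ℝ → ℝ := fun n => (Set.Ici (l n)).indicator fun t => a n * exp (-t) with hF
  -- Each `exp (-l n)` is the integral of `exp (-t)` over `t ≥ l n`. Absolute summability then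
  -- permits exchanging sum and integral.
  have hint : ∀ n, ∀ b : ℝ, ∫ t in Set.Ici (0 : ℝ),
      (Set.Ici (l n)).indicator (fun t => b * exp (-t)) t = b * exp (-l n) := fun n b => by
    rw [setIntegral_indicator measurableSet_Ici, Set.Ici_inter_Ici, sup_eq_right.2 (hl n),
      integral_Ici_eq_integral_Ioi, integral_const_mul, integral_exp_neg_Ioi]
  have hF_int : ∀ n, Integrable (F n) (volume.restrict (Set.Ici (0 : ℝ))) := fun n => by
    refine Integrable.indicator ?_ measurableSet_Ici
    have h : IntegrableOn (fun t : ℝ => exp (-t)) (Set.Ici 0) :=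
      (integrableOn_Ici_iff_integrableOn_Ioi (by simp)).2 (integrableOn_exp_neg_Ioi 0)
    exact Integrable.const_mul h (a n)
  have hnorm : ∀ n, ∫ t in Set.Ici (0 : ℝ), ‖F n t‖ = ‖a n * exp (-l n)‖ := fun n => by
    rw [norm_mul, Real.norm_of_nonneg (exp_pos (-l n)).le, ← hint n ‖a n‖]
    congr 1 with t
    simp only [hF, Set.indicator_apply]
    split_ifs
    · rw [norm_mul, Real.norm_of_nonneg (exp_pos (-t)).le]
    · exact norm_zero
  have h := hasSum_integral_of_summable_integral_norm hF_int (by simpa only [hnorm] using hs.norm)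
  simp only [hF, hint] at h
  rw [integral_Ici_eq_integral_Ioi] at h
  simpa only [Set.indicator_apply, Set.mem_Ici] using h

/-- The coefficients of `mertensSum`, as a sequence indexed by the natural numbers. -/
noncomputable def mertensCoeff (n : ℕ) : ℝ := if n.Prime then -log (1 - 1 / (n : ℝ)) else 0

lemma mertensCoeff_nonneg (n : ℕ) : 0 ≤ mertensCoeff n := by
  unfold mertensCoeff
  split_ifs with h
  · have hb := inv_prime_bounds h.two_le
    linarith [(neg_log_one_sub_sub_bounds hb.2).1]
  · exact le_rfl

lemma mertensSum_eq_sum_range (n : ℕ) : mertensSum n = ∑ k ∈ range (n + 1), mertensCoeff k := by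
  rw [mertensSum, Nat.primesLE_eq_filter_range, sum_filter]
  rfl

lemma mertensSum_mono : Monotone mertensSum := fun m n h => by
  rw [mertensSum_eq_sum_range, mertensSum_eq_sum_range]
  exact sum_le_sum_of_subset_of_nonneg (range_mono (by lia)) fun k _ _ => mertensCoeff_nonneg k

lemma tsum_mertensCoeff_ite {s t : ℝ} (hs : 0 < s) :
    (∑' n : ℕ, if s * log n ≤ t then mertensCoeff n * exp (-t) else 0) =
      exp (-t) * mertensSum ⌊exp (t / s)⌋₊ := by
  rw [tsum_eq_sum (s := range (⌊exp (t / s)⌋₊ + 1)), mertensSum_eq_sum_range, mul_sum]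
  · refine sum_congr rfl fun n hn => ?_
    -- Since `log 0 = 0`, the index `0` may pass the test in the `if`; it is harmless because its
    -- coefficient vanishes.
    rcases Nat.eq_zero_or_pos n with rfl | hn0
    · simp [mertensCoeff, Nat.not_prime_zero]
    · have hn1 : (n : ℝ) ≤ exp (t / s) :=
        (Nat.le_floor_iff (exp_pos _).le).1 (Nat.lt_succ_iff.1 (mem_range.1 hn))
      have : log n ≤ t / s := (log_le_iff_le_exp (by exact_mod_cast hn0)).2 hn1
      rw [le_div_iff₀ hs] at this
      rw [if_pos (by linarith), mul_comm]
  · intro n hn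
    rw [mem_range, not_lt, Nat.add_one_le_iff, Nat.floor_lt (exp_pos _).le] at hn
    have hn0 : (0 : ℝ) < n := (exp_pos _).trans hn
    have : t / s < log n := (lt_log_iff_exp_lt hn0).2 hn
    rw [div_lt_iff₀ hs] at this
    rw [if_neg (by linarith)]

/-- The term `k = 0` contributes `1 / 0 = 0`. -/
lemma harmonic_eq_sum_range_inv (n : ℕ) :
    (harmonic n : ℝ) = ∑ k ∈ range (n + 1), 1 / (k : ℝ) := by
  rw [sum_range_succ', harmonic]
  simp

lemma harmonic_mono {m n : ℕ} (h : m ≤ n) : (harmonic m : ℝ) ≤ harmonic n := by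
  rw [harmonic_eq_sum_range_inv, harmonic_eq_sum_range_inv]
  exact sum_le_sum_of_subset_of_nonneg (range_mono (by lia)) fun k _ _ => by positivity

lemma harmonic_cast_nonneg (n : ℕ) : (0 : ℝ) ≤ harmonic n := by
  simpa using harmonic_mono n.zero_le

lemma harmonic_le_self (n : ℕ) : (harmonic n : ℝ) ≤ n := by
  induction n with
  | zero => simp
  | succ n ih =>
    rw [harmonic_succ]
    push_cast
    have : ((n : ℝ) + 1)⁻¹ ≤ 1 := inv_le_one_of_one_le₀ (by linarith [(Nat.cast_nonneg n : (0 : ℝ) ≤ n)])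
    linarith

lemma tsum_inv_ite {s t : ℝ} (hs : 0 < s) (ht : 0 < t) :
    (∑' n : ℕ, if s * n ≤ t then 1 / (n : ℝ) * exp (-t) else 0) =
      exp (-t) * harmonic ⌊t / s⌋₊ := by
  rw [tsum_eq_sum (s := range (⌊t / s⌋₊ + 1)), harmonic_eq_sum_range_inv, mul_sum]
  · refine sum_congr rfl fun n hn => ?_
    have : (n : ℝ) ≤ t / s :=
      (Nat.le_floor_iff (by positivity)).1 (Nat.lt_succ_iff.1 (mem_range.1 hn))
    rw [le_div_iff₀ hs] at this
    rw [if_pos (by linarith), mul_comm]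
  · intro n hn
    rw [mem_range, not_lt, Nat.add_one_le_iff, Nat.floor_lt (by positivity), div_lt_iff₀ hs] at hn
    rw [if_neg (by linarith)]

/-- The difference of `mertensSum` and the harmonic sum, on a logarithmic scale. -/
noncomputable def mertensDiff (u : ℝ) : ℝ := mertensSum ⌊exp u⌋₊ - harmonic ⌊u⌋₊

lemma tendsto_log_floor_sub_log :
    Tendsto (fun x : ℝ => log (⌊x⌋₊ : ℝ) - log x) atTop (𝓝 0) := by
  have h : Tendsto (fun x : ℝ => (⌊x⌋₊ : ℝ) / x) atTop (𝓝 1) := tendsto_nat_floor_div_atTop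
  have h2 := (continuousAt_log one_ne_zero).tendsto.comp h
  rw [log_one] at h2
  refine h2.congr' ?_
  filter_upwards [eventually_ge_atTop 1] with x hx
  have : 0 < ⌊x⌋₊ := Nat.floor_pos.2 hx
  rw [Function.comp_apply, log_div (by exact_mod_cast this.ne') (by linarith)]

lemma tendsto_log_log_floor_exp_sub_log :
    Tendsto (fun u : ℝ => log (log (⌊exp u⌋₊ : ℝ)) - log u) atTop (𝓝 0) := by
  have h1 : Tendsto (fun u : ℝ => log (⌊exp u⌋₊ : ℝ) - u) atTop (𝓝 0) :=
    (tendsto_log_floor_sub_log.comp tendsto_exp_atTop).congr fun u => by simp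
  have h2 : Tendsto (fun u : ℝ => log (⌊exp u⌋₊ : ℝ) / u) atTop (𝓝 1) := by
    have := (h1.mul tendsto_inv_atTop_zero).const_add 1
    rw [zero_mul, add_zero] at this
    refine this.congr' ?_
    filter_upwards [eventually_gt_atTop 0] with u hu
    field_simp
    ring
  have h3 := (continuousAt_log one_ne_zero).tendsto.comp h2
  rw [log_one] at h3
  refine h3.congr' ?_
  filter_upwards [eventually_gt_atTop 1] with u hu
  have h4 : 2 ≤ ⌊exp u⌋₊ := Nat.le_floor (by push_cast; linarith [add_one_le_exp u])
  have h5 : 0 < log (⌊exp u⌋₊ : ℝ) := log_pos (by exact_mod_cast h4)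
  rw [Function.comp_apply, log_div h5.ne' (by linarith)]

lemma tendsto_mertensDiff {c : ℝ}
    (hc : Tendsto (fun n : ℕ => mertensSum n - log (log n)) atTop (𝓝 c)) :
    Tendsto mertensDiff atTop (𝓝 (c - eulerMascheroniConstant)) := by
  have h1 := hc.comp (tendsto_nat_floor_atTop.comp tendsto_exp_atTop)
  have h2 := tendsto_harmonic_sub_log.comp (tendsto_nat_floor_atTop (α := ℝ))
  have h3 := (h1.sub h2).add (tendsto_log_log_floor_exp_sub_log.sub tendsto_log_floor_sub_log)
  rw [sub_zero, add_zero] at h3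
  refine h3.congr fun u => ?_
  simp only [Function.comp_apply, mertensDiff]
  ring

/-- Convergence bounds the function beyond some `U`; below `U` both monotone parts are bounded by
their values at `U`. The bound supplies the dominating function for the integrals below. -/
lemma exists_abs_mertensDiff_le {L : ℝ} (h : Tendsto mertensDiff atTop (𝓝 L)) :
    ∃ K : ℝ, ∀ u, 0 ≤ u → |mertensDiff u| ≤ K := by
  obtain ⟨U, hU⟩ := eventually_atTop.1 (h.abs.eventually_le_const (lt_add_one |L|))
  have hA : ∀ n, 0 ≤ mertensSum n := fun n => by
    rw [mertensSum_eq_sum_range]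
    exact sum_nonneg fun k _ => mertensCoeff_nonneg k
  refine ⟨max (|L| + 1) (mertensSum ⌊exp U⌋₊ + harmonic ⌊U⌋₊), fun u hu => ?_⟩
  rcases le_total U u with h1 | h1
  · exact (hU u h1).trans (le_max_left _ _)
  · refine le_trans ?_ (le_max_right _ _)
    have e1 := mertensSum_mono (Nat.floor_mono (exp_le_exp.2 h1))
    have e2 := harmonic_mono (Nat.floor_mono h1)
    have e3 := hA ⌊exp u⌋₊
    have e4 := harmonic_cast_nonneg ⌊u⌋₊
    rw [mertensDiff, abs_le]
    constructor <;> linarith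

lemma measurable_mertensDiff : Measurable mertensDiff := by
  unfold mertensDiff
  refine Measurable.sub ?_ ?_
  · exact (measurable_from_top (f := mertensSum)).comp (Nat.measurable_floor.comp measurable_exp)
  · exact (measurable_from_top (f := fun n : ℕ => (harmonic n : ℝ))).comp Nat.measurable_floor

/-- For fixed `t > 0`, `t / s → ∞` as `s → 0⁺`, and `exp (-t)` has total mass `1`. -/
lemma tendsto_integral_exp_neg_mul_mertensDiff {L : ℝ} (h : Tendsto mertensDiff atTop (𝓝 L)) :
    Tendsto (fun s : ℝ => ∫ t in Set.Ioi (0 : ℝ), exp (-t) * mertensDiff (t / s))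
      (𝓝[>] 0) (𝓝 L) := by
  obtain ⟨K, hK⟩ := exists_abs_mertensDiff_le h
  have hL : L = ∫ t in Set.Ioi (0 : ℝ), exp (-t) * L := by
    rw [integral_mul_const, integral_exp_neg_Ioi]
    simp
  rw [show 𝓝 L = 𝓝 (∫ t in Set.Ioi (0 : ℝ), exp (-t) * L) by rw [← hL]]
  refine tendsto_integral_filter_of_dominated_convergence (fun t => exp (-t) * K)
    (.of_forall fun s => ?_) ?_ ((integrableOn_exp_neg_Ioi 0).mul_const K) ?_
  · exact ((measurable_exp.comp measurable_neg).mul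
      (measurable_mertensDiff.comp (measurable_id.div_const s))).aestronglyMeasurable
  · filter_upwards [self_mem_nhdsWithin] with s hs
    filter_upwards [ae_restrict_mem measurableSet_Ioi] with t ht
    rw [norm_mul, Real.norm_of_nonneg (exp_pos _).le]
    exact mul_le_mul_of_nonneg_left (hK _ (div_nonneg (le_of_lt ht) (le_of_lt hs))) (exp_pos _).le
  · filter_upwards [ae_restrict_mem measurableSet_Ioi] with t ht
    refine (h.comp ?_).const_mul _
    exact (tendsto_inv_nhdsGT_zero.const_mul_atTop ht).congr fun s => (div_eq_mul_inv _ _).symm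

lemma exp_neg_mul_log {s : ℝ} {n : ℕ} (hn : 0 < n) : exp (-(s * log n)) = (n : ℝ) ^ (-s) := by
  rw [rpow_def_of_pos (by exact_mod_cast hn)]
  congr 1
  ring

lemma summable_mertensCoeff_mul {s : ℝ} (hs : 0 < s) :
    Summable fun n : ℕ => mertensCoeff n * exp (-(s * log n)) := by
  have h : Summable fun n : ℕ => 2 * (n : ℝ) ^ (-(1 + s)) :=
    (Real.summable_nat_rpow.2 (by linarith)).mul_left 2
  refine h.of_norm_bounded fun n => ?_
  rw [norm_mul, Real.norm_of_nonneg (exp_pos _).le, Real.norm_of_nonneg (mertensCoeff_nonneg n)]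
  unfold mertensCoeff
  split_ifs with hp
  · have hb := inv_prime_bounds hp.two_le
    have h2 := (neg_log_one_sub_sub_bounds hb.2).2
    have hn : (0 : ℝ) < n := by exact_mod_cast hp.pos
    rw [exp_neg_mul_log hp.pos, neg_add, rpow_add hn, ← mul_assoc, rpow_neg_one, ← one_div]
    refine mul_le_mul_of_nonneg_right ?_ (by positivity)
    nlinarith
  · rw [zero_mul]
    positivity

lemma hasSum_inv_mul_exp {s : ℝ} (hs : 0 < s) :
    HasSum (fun n : ℕ => 1 / (n : ℝ) * exp (-(s * n))) (-log (1 - exp (-s))) := by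
  have h := hasSum_pow_div_log_of_abs_lt_one (x := exp (-s)) (by
    rw [abs_of_pos (exp_pos _)]
    exact Real.exp_lt_one_iff.2 (by linarith))
  rw [← hasSum_nat_add_iff' 1]
  simp only [range_one, sum_singleton, Nat.cast_zero, div_zero, zero_mul, sub_zero]
  refine Eq.mp (congrArg (HasSum · _) (funext fun n => ?_)) h
  rw [← exp_nat_mul]
  push_cast
  rw [show -(s * ((n : ℝ) + 1)) = ((n : ℝ) + 1) * -s by ring]
  ring

lemma tsum_sub_eq_integral {s : ℝ} (hs : 0 < s) :
    ∑' n : ℕ, mertensCoeff n * exp (-(s * log n)) + log (1 - exp (-s)) =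
      ∫ t in Set.Ioi (0 : ℝ), exp (-t) * mertensDiff (t / s) := by
  obtain ⟨c, hc⟩ := exists_tendsto_mertensSum_sub_log_log
  obtain ⟨K, hK⟩ := exists_abs_mertensDiff_le (tendsto_mertensDiff hc)
  have hD : IntegrableOn (fun t => exp (-t) * mertensDiff (t / s)) (Set.Ioi (0 : ℝ)) := by
    refine Integrable.mono' ((integrableOn_exp_neg_Ioi 0).mul_const K) ?_ ?_
    · exact ((measurable_exp.comp measurable_neg).mul
        (measurable_mertensDiff.comp (measurable_id.div_const s))).aestronglyMeasurable
    · filter_upwards [ae_restrict_mem measurableSet_Ioi] with t ht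
      rw [norm_mul, Real.norm_of_nonneg (exp_pos _).le]
      exact mul_le_mul_of_nonneg_left (hK _ (div_nonneg (le_of_lt ht) hs.le)) (exp_pos _).le
  have hH : IntegrableOn (fun t => exp (-t) * (harmonic ⌊t / s⌋₊ : ℝ)) (Set.Ioi (0 : ℝ)) := by
    -- The harmonic number is at most `t / s`, so the integrand of `Γ(2)` dominates.
    have hG := (Real.GammaIntegral_convergent (s := 2) (by norm_num)).mul_const (1 / s)
    refine Integrable.mono' hG ?_ ?_
    · exact ((measurable_exp.comp measurable_neg).mul
        ((measurable_from_top (f := fun n : ℕ => (harmonic n : ℝ))).comp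
          (Nat.measurable_floor.comp (measurable_id.div_const s)))).aestronglyMeasurable
    · filter_upwards [ae_restrict_mem measurableSet_Ioi] with t ht
      have ht' : 0 ≤ t / s := div_nonneg (le_of_lt ht) hs.le
      rw [norm_mul, Real.norm_of_nonneg (exp_pos _).le,
        Real.norm_of_nonneg (harmonic_cast_nonneg _), mul_assoc]
      refine mul_le_mul_of_nonneg_left
        ((harmonic_le_self _).trans ((Nat.floor_le ht').trans (le_of_eq ?_))) (exp_pos _).le
      norm_num
      rw [div_eq_mul_inv]
  have h1 := (hasSum_mul_exp_neg (a := mertensCoeff) (l := fun n => s * log n)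
    (fun n => mul_nonneg hs.le (log_natCast_nonneg n)) (summable_mertensCoeff_mul hs)).tsum_eq
  have h2 := (hasSum_mul_exp_neg (a := fun n => 1 / (n : ℝ)) (l := fun n => s * n)
    (fun n => by positivity) (hasSum_inv_mul_exp hs).summable).tsum_eq
  rw [(hasSum_inv_mul_exp hs).tsum_eq] at h2
  simp only [tsum_mertensCoeff_ite hs] at h1
  rw [setIntegral_congr_fun measurableSet_Ioi (fun t ht => tsum_inv_ite hs ht)] at h2
  have h3 := integral_add hD hH
  rw [← h2] at h3
  rw [h1, ← sub_eq_iff_eq_add.2 h3, sub_neg_eq_add]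
  congr 2 with t
  rw [mertensDiff]
  ring

lemma tsum_prime_neg_log {s : ℝ} (hs : 0 < s) :
    ∑' n : ℕ, (if n.Prime then -log (1 - (n : ℝ) ^ (-(1 + s))) else 0) =
      log (∑' n : ℕ, 1 / (n : ℝ) ^ (1 + s)) := by
  let f : ℕ →*₀ ℝ :=
    { toFun := fun n => (n : ℝ) ^ (-(1 + s))
      map_zero' := by
        rw [Nat.cast_zero, zero_rpow (by linarith)]
      map_one' := by simp
      map_mul' := fun m n => by
        rw [Nat.cast_mul, mul_rpow (Nat.cast_nonneg m) (Nat.cast_nonneg n)] }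
  have hfdef : ∀ n, f n = (n : ℝ) ^ (-(1 + s)) := fun n => rfl
  have hsum : Summable fun n : ℕ => (n : ℝ) ^ (-(1 + s)) :=
    Real.summable_nat_rpow.2 (by linarith)
  have hnorm : Summable (‖f ·‖) := hsum.norm
  have hprod := EulerProduct.eulerProduct_completely_multiplicative_hasProd hnorm
  have hlt : ∀ p : Nat.Primes, 0 < 1 - f p := fun p => by
    rw [hfdef, sub_pos]
    exact rpow_lt_one_of_one_lt_of_neg (by exact_mod_cast p.2.one_lt) (by linarith)
  have hlog : Summable fun p : Nat.Primes => log ((1 - f p)⁻¹) := by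
    have h1 : Summable fun p : Nat.Primes => -f p :=
      (hsum.comp_injective Nat.Primes.coe_nat_injective).neg
    refine (Real.summable_log_one_add_of_summable h1).neg.congr fun p => ?_
    rw [log_inv, sub_eq_add_neg]
  have h := Real.rexp_tsum_eq_tprod (fun p => inv_pos.2 (hlt p)) hlog
  rw [hprod.tprod_eq] at h
  have hf : ∑' n : ℕ, 1 / (n : ℝ) ^ (1 + s) = ∑' n, f n := by
    refine tsum_congr fun n => ?_
    rw [hfdef, rpow_neg (Nat.cast_nonneg n), one_div]
  rw [hf, ← h, log_exp]
  have := tsum_subtype {n : ℕ | n.Prime} fun n => -log (1 - (n : ℝ) ^ (-(1 + s)))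
  simp only [Set.indicator_apply, Set.mem_ofPred_eq] at this
  rw [← this]
  refine tsum_congr fun p => ?_
  rw [log_inv]
  rfl

/-- Compares the logarithm of the Euler product with the Dirichlet series of `mertensCoeff`. With `x
= 1/p` and `y = p^{-s} ≤ 1`, both terms lie between `xy` and `xy + 2x²`, so `2/p²` dominates; each
difference vanishes at `s = 0`. -/
lemma tendsto_tsum_prime_sub :
    Tendsto (fun s : ℝ => ∑' n : ℕ,
      ((if n.Prime then -log (1 - (n : ℝ) ^ (-(1 + s))) else 0) -
        mertensCoeff n * exp (-(s * log n)))) (𝓝[>] 0) (𝓝 0) := by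
  have hb : Summable fun n : ℕ => 2 * (1 / (n : ℝ) ^ 2) :=
    (Real.summable_one_div_nat_pow.2 one_lt_two).mul_left 2
  rw [show 𝓝 (0 : ℝ) = 𝓝 (∑' _ : ℕ, (0 : ℝ)) by rw [tsum_zero]]
  refine tendsto_tsum_of_dominated_convergence hb (fun n => ?_) ?_
  · unfold mertensCoeff
    split_ifs with hp
    · have hn : (0 : ℝ) < n := by exact_mod_cast hp.pos
      have hb := inv_prime_bounds hp.two_le
      have hcont : ContinuousAt (fun s : ℝ => -log (1 - (n : ℝ) ^ (-(1 + s))) -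
          -log (1 - 1 / (n : ℝ)) * exp (-(s * log n))) 0 := by
        have h1 : 1 - (n : ℝ) ^ (-(1 + (0 : ℝ))) ≠ 0 := by
          rw [add_zero, rpow_neg_one, ← one_div]
          linarith
        have h2 : ContinuousAt (fun s : ℝ => (n : ℝ) ^ (-(1 + s))) 0 :=
          (continuousAt_const_rpow hn.ne').comp (by fun_prop)
        exact ((continuousAt_const.sub h2).log h1).neg.sub (by fun_prop)
      have h3 := hcont.tendsto
      simp only [add_zero, rpow_neg_one, zero_mul, neg_zero, exp_zero, mul_one, one_div,
        sub_self] at h3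
      simp only [one_div]
      exact h3.mono_left nhdsWithin_le_nhds
    · simp
  · filter_upwards [self_mem_nhdsWithin] with s hs n
    unfold mertensCoeff
    split_ifs with hp
    · have hn : (0 : ℝ) < n := by exact_mod_cast hp.pos
      have hb := inv_prime_bounds hp.two_le
      have h2 := neg_log_one_sub_sub_bounds hb.2
      rw [exp_neg_mul_log hp.pos, neg_add, rpow_add hn, rpow_neg_one, ← one_div]
      set x := 1 / (n : ℝ)
      set y := (n : ℝ) ^ (-s)
      have hy0 : 0 < y := rpow_pos_of_pos hn _
      have hy1 : y ≤ 1 := rpow_le_one_of_one_le_of_nonpos (by exact_mod_cast hp.one_le)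
        (by linarith [Set.mem_Ioi.1 hs])
      have hxy : x * y ≤ x := mul_le_of_le_one_right hb.1 hy1
      have h3 := neg_log_one_sub_sub_bounds (hxy.trans hb.2)
      have e1 : (x * y) ^ 2 ≤ x ^ 2 := pow_le_pow_left₀ (by positivity) hxy 2
      have e2 : (-log (1 - x) - x) * y ≤ -log (1 - x) - x := mul_le_of_le_one_right h2.1 hy1
      have e3 : 0 ≤ (-log (1 - x) - x) * y := mul_nonneg h2.1 hy0.le
      have e4 : 1 / (n : ℝ) ^ 2 = x ^ 2 := by rw [div_pow, one_pow]
      rw [e4, Real.norm_eq_abs, abs_le]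
      constructor <;> nlinarith
    · simp

/-- Up to `o(1)` the series is `log ζ(1 + s)`, and `s ζ(1 + s)` and `(1 - e^{-s}) / s` both tend to
`1`, so the logarithms of `s` cancel. -/
lemma tendsto_tsum_mertensCoeff_add_log :
    Tendsto (fun s : ℝ => ∑' n : ℕ, mertensCoeff n * exp (-(s * log n)) + log (1 - exp (-s)))
      (𝓝[>] 0) (𝓝 0) := by
  have hz : Tendsto (fun s : ℝ => log (s * ∑' n : ℕ, 1 / (n : ℝ) ^ (1 + s))) (𝓝[>] 0) (𝓝 0) := by
    have h1 : Tendsto (fun s : ℝ => 1 + s) (𝓝[>] 0) (𝓝[>] 1) := by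
      refine tendsto_nhdsWithin_iff.2 ⟨?_, ?_⟩
      · have : ContinuousAt (fun s : ℝ => 1 + s) 0 := by fun_prop
        simpa using this.tendsto.mono_left nhdsWithin_le_nhds
      · filter_upwards [self_mem_nhdsWithin] with s hs
        simpa using hs
    have h2 := tendsto_sub_mul_tsum_nat_rpow.comp h1
    have h3 := (continuousAt_log one_ne_zero).tendsto.comp h2
    rw [log_one] at h3
    refine h3.congr fun s => ?_
    simp
  have he : Tendsto (fun s : ℝ => log ((1 - exp (-s)) / s)) (𝓝[>] 0) (𝓝 0) := by
    have h1 : HasDerivAt (fun s : ℝ => 1 - exp (-s)) 1 0 := by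
      have := ((hasDerivAt_id (0 : ℝ)).neg.exp).const_sub 1
      simpa using this
    have h2 := (hasDerivAt_iff_tendsto_slope.1 h1).mono_left
      (nhdsWithin_mono 0 (fun x (hx : 0 < x) => hx.ne'))
    have h3 := (continuousAt_log one_ne_zero).tendsto.comp h2
    rw [log_one] at h3
    refine h3.congr fun s => ?_
    simp [slope_def_field]
  have h := (hz.add he).sub tendsto_tsum_prime_sub
  rw [add_zero, sub_zero] at h
  refine h.congr' ?_
  filter_upwards [self_mem_nhdsWithin] with s hs
  have hs' : (0 : ℝ) < s := hs
  have hsz : Summable fun n : ℕ => 1 / (n : ℝ) ^ (1 + s) :=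
    Real.summable_one_div_nat_rpow.2 (by linarith)
  have hZ : 0 < ∑' n : ℕ, 1 / (n : ℝ) ^ (1 + s) :=
    hsz.tsum_pos (fun n => by positivity) 1 (by simp)
  have hexp : 0 < 1 - exp (-s) := by
    have := Real.exp_lt_one_iff.2 (by linarith : -s < 0)
    linarith
  have hsp : Summable fun n : ℕ =>
      if n.Prime then -log (1 - (n : ℝ) ^ (-(1 + s))) else 0 := by
    have h1 : Summable fun n : ℕ => -(n : ℝ) ^ (-(1 + s)) :=
      (Real.summable_nat_rpow.2 (by linarith)).neg
    have h2 := (Real.summable_log_one_add_of_summable h1).neg.indicator {n : ℕ | n.Prime}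
    refine h2.congr fun n => ?_
    simp only [Set.indicator_apply, Set.mem_ofPred_eq, sub_eq_add_neg]
  rw [hsp.tsum_sub (summable_mertensCoeff_mul hs'), tsum_prime_neg_log hs',
    log_mul hs'.ne' hZ.ne', log_div hexp.ne' hs'.ne']
  ring

/-- **Mertens' third theorem**, in logarithmic form. -/
lemma tendsto_mertensSum_sub_log_log :
    Tendsto (fun n : ℕ => mertensSum n - log (log n)) atTop (𝓝 eulerMascheroniConstant) := by
  obtain ⟨c, hc⟩ := exists_tendsto_mertensSum_sub_log_log
  have h1 := tendsto_integral_exp_neg_mul_mertensDiff (tendsto_mertensDiff hc)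
  have h2 : Tendsto (fun s : ℝ => ∫ t in Set.Ioi (0 : ℝ), exp (-t) * mertensDiff (t / s))
      (𝓝[>] 0) (𝓝 0) := by
    refine tendsto_tsum_mertensCoeff_add_log.congr' ?_
    filter_upwards [self_mem_nhdsWithin] with s hs using tsum_sub_eq_integral hs
  have h3 := tendsto_nhds_unique h1 h2
  rwa [sub_eq_zero.1 h3] at hc

end Mertens

/-! ### Counting admissible residues by the Chinese remainder theorem. -/

section Counting

open Finset

lemma card_filter_range_mul {a b : ℕ} (hab : a.Coprime b) (ha : 0 < a) (hb : 0 < b)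
    (Q R : ℕ → Prop) [DecidablePred Q] [DecidablePred R]
    (hQ : ∀ m n, m ≡ n [MOD a] → (Q m ↔ Q n)) (hR : ∀ m n, m ≡ n [MOD b] → (R m ↔ R n)) :
    #{n ∈ range (a * b) | Q n ∧ R n} = #{n ∈ range a | Q n} * #{n ∈ range b | R n} := by
  rw [← card_product]
  refine card_bij (fun n _ => (n % a, n % b)) (fun n hn => ?_) (fun m hm n hn h => ?_)
    fun x hx => ?_
  · simp only [mem_product, mem_filter, mem_range] at hn ⊢
    exact ⟨⟨Nat.mod_lt _ ha, (hQ _ _ (Nat.mod_modEq n a)).2 hn.2.1⟩,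
      Nat.mod_lt _ hb, (hR _ _ (Nat.mod_modEq n b)).2 hn.2.2⟩
  · simp only [Prod.mk.injEq] at h
    simp only [mem_filter, mem_range] at hm hn
    exact ((Nat.modEq_and_modEq_iff_modEq_mul hab).1 ⟨h.1, h.2⟩).eq_of_lt_of_lt hm.1 hn.1
  · simp only [mem_product, mem_filter, mem_range] at hx
    obtain ⟨k, hk1, hk2⟩ := Nat.chineseRemainder hab x.1 x.2
    have h1 : k % (a * b) ≡ x.1 [MOD a] := ((Nat.mod_modEq k (a * b)).of_mul_right b).trans hk1
    have h2 : k % (a * b) ≡ x.2 [MOD b] := ((Nat.mod_modEq k (a * b)).of_mul_left a).trans hk2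
    refine ⟨k % (a * b), ?_, ?_⟩
    · simp only [mem_filter, mem_range]
      exact ⟨Nat.mod_lt _ (Nat.mul_pos ha hb), (hQ _ _ h1).2 hx.1.2, (hR _ _ h2).2 hx.2.2⟩
    · exact Prod.ext (Nat.mod_eq_of_modEq h1 hx.1.1) (Nat.mod_eq_of_modEq h2 hx.2.1)

/-- The Chinese remainder theorem, as a count of residues modulo a product of primes. -/
lemma card_filter_range_prod_primes (S : Finset ℕ) (hS : ∀ p ∈ S, p.Prime)
    (Q : ℕ → ℕ → Prop) [∀ p, DecidablePred (Q p)]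
    (hQ : ∀ p m n, m ≡ n [MOD p] → (Q p m ↔ Q p n)) :
    #{n ∈ range (∏ p ∈ S, p) | ∀ p ∈ S, Q p n} = ∏ p ∈ S, #{n ∈ range p | Q p n} := by
  induction S using Finset.induction_on with
  | empty => simp
  | insert p S hp ih =>
    have hS' : ∀ q ∈ S, q.Prime := fun q hq => hS q (mem_insert_of_mem hq)
    have hpp := hS p (mem_insert_self p S)
    simp only [prod_insert hp, forall_mem_insert]
    rw [← ih hS']
    refine card_filter_range_mul (Nat.Coprime.prod_right fun q hq => ?_) hpp.pos
      (prod_pos fun q hq => (hS' q hq).pos) _ _ (hQ p) fun m n h => ?_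
    · exact (Nat.coprime_primes hpp (hS' q hq)).2 fun h => hp (h ▸ hq)
    · exact forall₂_congr fun q hq => hQ q m n (h.of_dvd (dvd_prod_of_mem _ hq))

lemma card_filter_Icc_primorial (m : ℕ) (Q : ℕ → ℕ → Prop) [∀ p, DecidablePred (Q p)]
    (hQ : ∀ p m n, m ≡ n [MOD p] → (Q p m ↔ Q p n)) :
    #{n ∈ Icc 1 (primorial m) | ∀ p ∈ Nat.primesLE m, Q p n} =
      ∏ p ∈ Nat.primesLE m, #{n ∈ range p | Q p n} := by
  rw [← card_filter_range_prod_primes _ (fun p => Nat.prime_of_mem_primesLE) Q hQ,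
    ← primorial_eq_prod_primesLE]
  -- Periodicity moves the count from `[1, P]` to `[0, P)`.
  have hper : Function.Periodic (fun n => ∀ p ∈ Nat.primesLE m, Q p n) (primorial m) := fun n =>
    propext <| forall₂_congr fun p hp => hQ p _ _ <| by
      have : p ∣ primorial m := by
        rw [primorial_eq_prod_primesLE]
        exact dvd_prod_of_mem _ hp
      have h2 := (Nat.modEq_zero_iff_dvd.2 this).add_left n
      simpa using h2
  have h1 := Nat.filter_Ico_card_eq_of_periodic 1 (primorial m) _ hper
  rw [← Nat.count_eq_card_filter_range, ← h1, Nat.add_comm, Ico_add_one_right_eq_Icc]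

lemma gcd_eq_one_iff_forall_prime (a b : ℕ) :
    Nat.gcd a b = 1 ↔ ∀ p : ℕ, p.Prime → p ∣ b → ¬ p ∣ a := by
  rw [← not_iff_not, ← Nat.Coprime, Nat.Prime.not_coprime_iff_dvd]
  push Not
  exact exists_congr fun p => by tauto

/-- For squarefree `P`, dividing by `gcd(P, n)` removes each prime shared with `n` completely. -/
lemma prime_dvd_cofactor_iff {P n p : ℕ} (hP : Squarefree P) (hp : p.Prime) :
    p ∣ cofactor P n ↔ p ∣ P ∧ ¬ p ∣ n := by
  have hmul : Nat.gcd P n * cofactor P n = P := Nat.mul_div_cancel' (Nat.gcd_dvd_left P n)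
  have hco : (Nat.gcd P n).Coprime (cofactor P n) :=
    Nat.coprime_of_squarefree_mul (hmul.symm ▸ hP)
  constructor
  · intro h
    have hpP : p ∣ P := hmul ▸ h.mul_left _
    exact ⟨hpP, fun hn => hp.one_lt.ne'
      (Nat.eq_one_of_dvd_coprimes hco (Nat.dvd_gcd hpP hn) h)⟩
  · rintro ⟨h1, h2⟩
    rw [← hmul] at h1
    exact (hp.dvd_mul.1 h1).resolve_left fun h => h2 (h.trans (Nat.gcd_dvd_right P n))

/-- The residues allowed modulo `p` in the definition of `W`. -/
def GoodAt (N p n : ℕ) : Prop := ¬ (p : ℤ) ∣ ((N : ℤ) - n) * ((N : ℤ) + n)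

/-- The residues allowed modulo `p` in the definition of `Wd 1`. -/
def CoprimeGoodAt (N p n : ℕ) : Prop := GoodAt N p n ∧ (¬ p ∣ 6 * N → ¬ p ∣ n)

instance (N p : ℕ) : DecidablePred (GoodAt N p) := fun _ => inferInstanceAs (Decidable (¬ _))

instance (N p : ℕ) : DecidablePred (CoprimeGoodAt N p) := fun _ =>
  inferInstanceAs (Decidable (_ ∧ _))

lemma GoodAt.congr {N p m n : ℕ} (h : m ≡ n [MOD p]) : GoodAt N p m ↔ GoodAt N p n := by
  have h' : (m : ZMod p) = n := (ZMod.natCast_eq_natCast_iff m n p).2 h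
  simp only [GoodAt, ← ZMod.intCast_zmod_eq_zero_iff_dvd]
  push_cast
  rw [h']

lemma CoprimeGoodAt.congr {N p m n : ℕ} (h : m ≡ n [MOD p]) :
    CoprimeGoodAt N p m ↔ CoprimeGoodAt N p n := by
  rw [CoprimeGoodAt, CoprimeGoodAt, GoodAt.congr h, h.dvd_iff dvd_rfl]

lemma W_primorial (m N : ℕ) :
    W (primorial m) N = {n ∈ Icc 1 (primorial m) | ∀ p ∈ Nat.primesLE m, GoodAt N p n} := by
  refine filter_congr fun n _ => ?_
  rw [Int.gcd, Int.natAbs_natCast, gcd_eq_one_iff_forall_prime]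
  simp only [Nat.mem_primesLE, GoodAt, Int.natCast_dvd]
  exact ⟨fun h p hp => h p hp.2 (hp.2.dvd_primorial_iff.2 hp.1),
    fun h p hp hd => h p ⟨hp.dvd_primorial_iff.1 hd, hp⟩⟩

lemma Wd_one_primorial (m N : ℕ) :
    Wd 1 (primorial m) N =
      {n ∈ Icc 1 (primorial m) | ∀ p ∈ Nat.primesLE m, CoprimeGoodAt N p n} := by
  rw [Wd, W_primorial, filter_filter]
  refine filter_congr fun n _ => ?_
  rw [Nat.gcd_comm, gcd_eq_one_iff_forall_prime]
  simp only [Nat.mem_primesLE, CoprimeGoodAt]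
  constructor
  · exact fun h p hp => ⟨h.1 p hp, fun hN => h.2 p hp.2
      ((prime_dvd_cofactor_iff (squarefree_primorial m) hp.2).2
        ⟨hp.2.dvd_primorial_iff.2 hp.1, hN⟩)⟩
  · refine fun h => ⟨fun p hp => (h p hp).1, fun p hp hd => ?_⟩
    obtain ⟨h1, h2⟩ := (prime_dvd_cofactor_iff (squarefree_primorial m) hp).1 hd
    exact (h p ⟨hp.dvd_primorial_iff.1 h1, hp⟩).2 h2

lemma card_filter_range_natCast {p : ℕ} [NeZero p] (R : ZMod p → Prop) [DecidablePred R] :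
    #{n ∈ range p | R (n : ℕ)} = #{x : ZMod p | R x} := by
  refine card_bij (fun n _ => (n : ZMod p)) (fun n hn => ?_) (fun m hm n hn h => ?_)
    fun x hx => ⟨x.val, ?_, by simp⟩
  · simpa using (mem_filter.1 hn).2
  · simp only [mem_filter, mem_range] at hm hn
    exact ((ZMod.natCast_eq_natCast_iff m n p).1 h).eq_of_lt_of_lt hm.1 hn.1
  · simpa [x.val_lt] using hx

lemma goodAt_iff {N p n : ℕ} (hp : p.Prime) :
    GoodAt N p n ↔ (n : ZMod p) ∉ ({(N : ZMod p), -(N : ZMod p)} : Finset (ZMod p)) := by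
  have := Fact.mk hp
  rw [GoodAt, ← ZMod.intCast_zmod_eq_zero_iff_dvd]
  push_cast
  rw [mul_eq_zero, sub_eq_zero, mem_insert, mem_singleton, eq_comm (a := (N : ZMod p)),
    add_comm (N : ZMod p), add_eq_zero_iff_eq_neg]

lemma card_goodAt {N p : ℕ} (hp : p.Prime) :
    #{n ∈ range p | GoodAt N p n} = p - #{(N : ZMod p), -(N : ZMod p)} := by
  have := Fact.mk hp
  simp only [goodAt_iff hp]
  rw [card_filter_range_natCast (fun x : ZMod p => x ∉ ({(N : ZMod p), -(N : ZMod p)} : Finset _)),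
    filter_not, filter_mem_eq_inter, univ_inter, ← compl_eq_univ_sdiff, card_compl, ZMod.card]

lemma card_coprimeGoodAt_of_dvd {N p : ℕ} (h : p ∣ 6 * N) :
    #{n ∈ range p | CoprimeGoodAt N p n} = #{n ∈ range p | GoodAt N p n} := by
  simp [CoprimeGoodAt, h]

lemma card_coprimeGoodAt_of_not_dvd {N p : ℕ} (hp : p.Prime) (h : ¬ p ∣ 6 * N) :
    #{n ∈ range p | CoprimeGoodAt N p n} = p - #{0, (N : ZMod p), -(N : ZMod p)} := by
  have := Fact.mk hp
  have h1 : ∀ n, CoprimeGoodAt N p n ↔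
      (n : ZMod p) ∉ ({0, (N : ZMod p), -(N : ZMod p)} : Finset (ZMod p)) := fun n => by
    rw [CoprimeGoodAt, goodAt_iff hp, mem_insert (a := (n : ZMod p)) (b := 0),
      ZMod.natCast_eq_zero_iff]
    tauto
  simp only [h1]
  rw [card_filter_range_natCast
      (fun x : ZMod p => x ∉ ({0, (N : ZMod p), -(N : ZMod p)} : Finset _)),
    filter_not, filter_mem_eq_inter, univ_inter, ← compl_eq_univ_sdiff, card_compl, ZMod.card]

lemma natCast_ne_neg_self {N p : ℕ} (hp : p.Prime) (h3 : 3 ≤ p) (hN : ¬ p ∣ N) :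
    (N : ZMod p) ≠ -(N : ZMod p) := by
  have := Fact.mk hp
  intro h
  have h2 : ((2 * N : ℕ) : ZMod p) = 0 := by
    push_cast
    linear_combination h
  rw [ZMod.natCast_eq_zero_iff, hp.dvd_mul] at h2
  exact h2.elim (fun h => by have := Nat.le_of_dvd two_pos h; lia) hN

lemma card_goodAt_two (N : ℕ) : #{n ∈ range 2 | GoodAt N 2 n} = 1 := by
  rw [card_goodAt Nat.prime_two, ZMod.neg_eq_self_mod_two]
  simp

lemma card_goodAt_of_dvd {N p : ℕ} (hp : p.Prime) (hN : p ∣ N) :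
    #{n ∈ range p | GoodAt N p n} = p - 1 := by
  rw [card_goodAt hp, (ZMod.natCast_eq_zero_iff N p).2 hN]
  simp

lemma card_goodAt_of_not_dvd {N p : ℕ} (hp : p.Prime) (h3 : 3 ≤ p) (hN : ¬ p ∣ N) :
    #{n ∈ range p | GoodAt N p n} = p - 2 := by
  rw [card_goodAt hp, card_pair (natCast_ne_neg_self hp h3 hN)]

lemma card_coprimeGoodAt_five_le {N p : ℕ} (hp : p.Prime) (h5 : 5 ≤ p) (hN : ¬ p ∣ N) :
    #{n ∈ range p | CoprimeGoodAt N p n} = p - 3 := by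
  have h6 : ¬ p ∣ 6 * N := fun h => by
    rcases hp.dvd_mul.1 h with h | h
    · have h7 := Nat.le_of_dvd (by norm_num) h
      interval_cases p <;> revert hp h <;> decide
    · exact hN h
  have h0 : (N : ZMod p) ≠ 0 := fun h => hN ((ZMod.natCast_eq_zero_iff N p).1 h)
  rw [card_coprimeGoodAt_of_not_dvd hp h6, card_insert_of_notMem, card_pair
    (natCast_ne_neg_self hp (by lia) hN)]
  rw [mem_insert, mem_singleton, not_or]
  exact ⟨h0.symm, fun h => h0 (neg_eq_zero.1 h.symm)⟩

end Counting

/-! ### Exact product formulas and their limits. -/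

section Asymptotics

open Finset Filter Topology Asymptotics

lemma primesIn_two (z : ℝ) : primesIn 2 z = Nat.primesLE ⌊z⌋₊ := by
  rw [primesIn, Nat.primesLE_eq_filter_Icc_two]

lemma mem_primesIn {a p : ℕ} {z : ℝ} : p ∈ primesIn a z ↔ (a ≤ p ∧ p ≤ ⌊z⌋₊) ∧ p.Prime := by
  rw [primesIn, mem_filter, mem_Icc]

lemma prod_primesIn_two {z : ℝ} (hz : 2 ≤ z) (f : ℕ → ℝ) :
    ∏ p ∈ primesIn 2 z, f p = f 2 * ∏ p ∈ primesIn 3 z, f p := by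
  have h2 : 2 ≤ ⌊z⌋₊ := Nat.le_floor (by exact_mod_cast hz)
  rw [← prod_insert (by simp [mem_primesIn])]
  refine prod_congr (Finset.ext fun p => ?_) fun _ _ => rfl
  simp only [mem_insert, mem_primesIn]
  constructor
  · rintro ⟨⟨h, h'⟩, hp⟩
    rcases h.eq_or_lt with h | h
    · exact .inl h.symm
    · exact .inr ⟨⟨h, h'⟩, hp⟩
  · rintro (rfl | ⟨⟨h, h'⟩, hp⟩)
    · exact ⟨⟨le_rfl, h2⟩, Nat.prime_two⟩
    · exact ⟨⟨by lia, h'⟩, hp⟩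

lemma prod_primesIn_three {z : ℝ} (hz : 3 ≤ z) (f : ℕ → ℝ) :
    ∏ p ∈ primesIn 3 z, f p = f 3 * ∏ p ∈ primesIn 5 z, f p := by
  have h3 : 3 ≤ ⌊z⌋₊ := Nat.le_floor (by exact_mod_cast hz)
  rw [← prod_insert (by simp [mem_primesIn])]
  refine prod_congr (Finset.ext fun p => ?_) fun _ _ => rfl
  simp only [mem_insert, mem_primesIn]
  constructor
  · rintro ⟨⟨h, h'⟩, hp⟩
    rcases h.eq_or_lt with h | h
    · exact .inl h.symm
    · have h4 : p ≠ 4 := by rintro rfl; revert hp; decide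
      exact .inr ⟨⟨by lia, h'⟩, hp⟩
  · rintro (rfl | ⟨⟨h, h'⟩, hp⟩)
    · exact ⟨⟨le_rfl, h3⟩, Nat.prime_three⟩
    · exact ⟨⟨by lia, h'⟩, hp⟩

lemma omega_primeProd (z : ℝ) (N : ℕ) :
    omega (primeProd z) N =
      ∏ p ∈ primesIn 2 z, (#{n ∈ range p | GoodAt N p n} : ℝ) / p := by
  rw [omega, primeProd, W_primorial, card_filter_Icc_primorial _ _ fun _ _ _ => GoodAt.congr,
    primesIn_two, prod_div_distrib, primorial_eq_prod_primesLE]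
  push_cast
  rfl

lemma omegaD_one_primeProd (z : ℝ) (N : ℕ) :
    omegaD 1 (primeProd z) N =
      ∏ p ∈ primesIn 2 z, (#{n ∈ range p | CoprimeGoodAt N p n} : ℝ) / p := by
  rw [omegaD, primeProd, Wd_one_primorial,
    card_filter_Icc_primorial _ _ fun _ _ _ => CoprimeGoodAt.congr,
    primesIn_two, prod_div_distrib, primorial_eq_prod_primesLE]
  push_cast
  rfl

/-- The leading `2` comes from `p = 2`, where the proportion is `1/2 = 2 · (1 - 1/2)²`. -/
lemma omega_formula (N : ℕ) {z : ℝ} (hz : 2 ≤ z) :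
    omega (primeProd z) N =
      2 * (∏ p ∈ primesIn 3 z, factor2 p) *
        (∏ p ∈ (primesIn 3 z).filter (fun p => p ∣ N), ((p : ℝ) - 1) / ((p : ℝ) - 2)) *
        ∏ p ∈ primesIn 2 z, (1 - 1 / (p : ℝ)) ^ 2 := by
  rw [omega_primeProd, prod_primesIn_two hz, prod_primesIn_two hz, card_goodAt_two, prod_filter]
  have h : ∏ p ∈ primesIn 3 z, (#{n ∈ range p | GoodAt N p n} : ℝ) / p =
      (∏ p ∈ primesIn 3 z, factor2 p) *
        (∏ p ∈ primesIn 3 z, if p ∣ N then ((p : ℝ) - 1) / ((p : ℝ) - 2) else 1) *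
        ∏ p ∈ primesIn 3 z, (1 - 1 / (p : ℝ)) ^ 2 := by
    rw [← prod_mul_distrib, ← prod_mul_distrib]
    refine prod_congr rfl fun p hp => ?_
    obtain ⟨⟨h3, -⟩, hp⟩ := mem_primesIn.1 hp
    have h3' : (3 : ℝ) ≤ p := by exact_mod_cast h3
    have e0 : (p : ℝ) ≠ 0 := by linarith
    have e1 : (p : ℝ) - 1 ≠ 0 := by linarith
    have e2 : (p : ℝ) - 2 ≠ 0 := by linarith
    rw [factor2]
    split_ifs with hN
    · rw [card_goodAt_of_dvd hp hN, Nat.cast_sub (by lia)]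
      push_cast
      field_simp
    · rw [card_goodAt_of_not_dvd hp h3 hN, Nat.cast_sub (by lia)]
      push_cast
      field_simp
  rw [h]
  push_cast
  ring

/-- As `3 ∣ 6N`, the class `0` is not excluded separately at `p = 3`. -/
lemma card_coprimeGoodAt_three_div (N : ℕ) :
    (#{n ∈ range 3 | CoprimeGoodAt N 3 n} : ℝ) / (3 : ℕ) = threeFactor N / 3 := by
  rw [card_coprimeGoodAt_of_dvd (dvd_mul_of_dvd_left (by norm_num) N), threeFactor]
  split_ifs with hN
  · rw [card_goodAt_of_dvd Nat.prime_three hN]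
    norm_num
  · rw [card_goodAt_of_not_dvd Nat.prime_three le_rfl hN]
    norm_num

/-- Normalising by `(1 - 1/p)³` leaves `4` at `p = 2` and `9/8` times `threeFactor N` at `p = 3`;
this is the source of `9/2`. -/
lemma omegaD_one_formula (N : ℕ) {z : ℝ} (hz : 3 ≤ z) :
    omegaD 1 (primeProd z) N =
      9 / 2 * (∏ p ∈ primesIn 5 z, factor3 p) * threeFactor N *
        (∏ p ∈ (primesIn 5 z).filter (fun p => p ∣ N), ((p : ℝ) - 1) / ((p : ℝ) - 3)) *
        ∏ p ∈ primesIn 2 z, (1 - 1 / (p : ℝ)) ^ 3 := by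
  have hz2 : 2 ≤ z := by linarith
  rw [omegaD_one_primeProd, prod_primesIn_two hz2, prod_primesIn_two hz2, prod_primesIn_three hz,
    prod_primesIn_three hz, card_coprimeGoodAt_three_div,
    card_coprimeGoodAt_of_dvd (dvd_mul_of_dvd_left (by norm_num) N), card_goodAt_two, prod_filter]
  have h : ∏ p ∈ primesIn 5 z, (#{n ∈ range p | CoprimeGoodAt N p n} : ℝ) / p =
      (∏ p ∈ primesIn 5 z, factor3 p) *
        (∏ p ∈ primesIn 5 z, if p ∣ N then ((p : ℝ) - 1) / ((p : ℝ) - 3) else 1) *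
        ∏ p ∈ primesIn 5 z, (1 - 1 / (p : ℝ)) ^ 3 := by
    rw [← prod_mul_distrib, ← prod_mul_distrib]
    refine prod_congr rfl fun p hp => ?_
    obtain ⟨⟨h5, -⟩, hp⟩ := mem_primesIn.1 hp
    have h5' : (5 : ℝ) ≤ p := by exact_mod_cast h5
    have e0 : (p : ℝ) ≠ 0 := by linarith
    have e1 : (p : ℝ) - 1 ≠ 0 := by linarith
    have e2 : (p : ℝ) - 3 ≠ 0 := by linarith
    rw [factor3]
    split_ifs with hN
    · rw [card_coprimeGoodAt_of_dvd (hN.mul_left 6), card_goodAt_of_dvd hp hN,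
        Nat.cast_sub (by lia)]
      push_cast
      field_simp
    · rw [card_coprimeGoodAt_five_le hp h5 hN, Nat.cast_sub (by lia)]
      push_cast
      field_simp
  rw [h]
  push_cast
  ring

/-- The logarithms are summable, and the product is the exponential of their sum, hence positive.
The constant `16` serves both applications: `factor2` needs `4`, and `factor3` needs `4 · 4`. -/
lemma multipliable_and_tprod_pos {a : ℕ} {f : ℕ → ℝ} (hpos : ∀ p, p.Prime → a ≤ p → 0 < f p)
    (hf : ∀ p, p.Prime → a ≤ p → |f p - 1| ≤ 16 * (1 / (p : ℝ) ^ 2)) :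
    Multipliable (fun p : {p : ℕ // p.Prime ∧ a ≤ p} => f p) ∧
      0 < ∏' p : {p : ℕ // p.Prime ∧ a ≤ p}, f p := by
  have hs : Summable fun p : {p : ℕ // p.Prime ∧ a ≤ p} => f p - 1 := by
    have h : Summable fun n : ℕ => 16 * (1 / (n : ℝ) ^ 2) :=
      (Real.summable_one_div_nat_pow.2 one_lt_two).mul_left 16
    exact (h.comp_injective Subtype.val_injective).of_norm_bounded fun p => hf p p.2.1 p.2.2
  have hlog := Real.summable_log_one_add_of_summable hs
  simp only [add_sub_cancel] at hlog
  have hpos' : ∀ p : {p : ℕ // p.Prime ∧ a ≤ p}, 0 < f p := fun p => hpos p p.2.1 p.2.2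
  exact ⟨Real.multipliable_of_summable_log hpos' hlog,
    Real.rexp_tsum_eq_tprod hpos' hlog ▸ Real.exp_pos _⟩

lemma one_div_sub_one_sq_le {x : ℝ} (hx : 2 ≤ x) : 1 / (x - 1) ^ 2 ≤ 4 * (1 / x ^ 2) := by
  rw [mul_one_div, div_le_div_iff₀ (pow_pos (by linarith) 2) (by positivity)]
  nlinarith

lemma multipliable_factor2 :
    Multipliable (fun p : {p : ℕ // p.Prime ∧ 3 ≤ p} => factor2 p) ∧ 0 < C₂ := by
  refine multipliable_and_tprod_pos (fun p _ h3 => ?_) fun p _ h3 => ?_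
  all_goals
    have h3' : (3 : ℝ) ≤ p := by exact_mod_cast h3
    have e1 : 0 < (p : ℝ) - 1 := by linarith
    have e2 : 0 < (p : ℝ) - 2 := by linarith
  · exact div_pos (mul_pos e2 (by linarith)) (by positivity)
  · have : factor2 p - 1 = -(1 / ((p : ℝ) - 1) ^ 2) := by
      rw [factor2]
      field_simp
      ring
    rw [this, abs_neg, abs_of_nonneg (by positivity)]
    refine (one_div_sub_one_sq_le (by linarith)).trans ?_
    have : 0 ≤ 1 / (p : ℝ) ^ 2 := by positivity
    linarith

lemma multipliable_factor3 :
    Multipliable (fun p : {p : ℕ // p.Prime ∧ 5 ≤ p} => factor3 p) ∧ 0 < C₃ := by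
  refine multipliable_and_tprod_pos (fun p _ h5 => ?_) fun p _ h5 => ?_
  all_goals
    have h5' : (5 : ℝ) ≤ p := by exact_mod_cast h5
    have e1 : 0 < (p : ℝ) - 1 := by linarith
    have e3 : 0 < (p : ℝ) - 3 := by linarith
  · exact div_pos (mul_pos e3 (by positivity)) (by positivity)
  · have : factor3 p - 1 = -((3 * p - 1) / ((p : ℝ) - 1) ^ 3) := by
      rw [factor3]
      field_simp
      ring
    rw [this, abs_neg, abs_of_nonneg (div_nonneg (by linarith) (by positivity))]
    have h4 : (3 * p - 1) / ((p : ℝ) - 1) ^ 3 ≤ 4 * (1 / ((p : ℝ) - 1) ^ 2) := by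
      rw [mul_one_div, div_le_div_iff₀ (by positivity) (by positivity)]
      have : 0 < ((p : ℝ) - 1) ^ 2 := by positivity
      nlinarith
    linarith [one_div_sub_one_sq_le (by linarith : (2 : ℝ) ≤ p)]

lemma tendsto_prod_primesIn {a : ℕ} {f : ℕ → ℝ}
    (h : Multipliable (fun p : {p : ℕ // p.Prime ∧ a ≤ p} => f p)) :
    Tendsto (fun z : ℝ => ∏ p ∈ primesIn a z, f p) atTop
      (𝓝 (∏' p : {p : ℕ // p.Prime ∧ a ≤ p}, f p)) := by
  have h1 : HasProd ({p : ℕ | p.Prime ∧ a ≤ p}.mulIndicator f)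
      (∏' p : {p : ℕ // p.Prime ∧ a ≤ p}, f p) :=
    hasProd_subtype_iff_mulIndicator.1 h.hasProd
  have h2 := h1.tendsto_prod_nat.comp
    ((tendsto_add_atTop_nat 1).comp (tendsto_nat_floor_atTop (α := ℝ)))
  refine h2.congr fun z => ?_
  simp only [Function.comp_apply, Set.mulIndicator_apply, Set.mem_ofPred_eq]
  rw [← prod_filter]
  refine prod_congr (Finset.ext fun p => ?_) fun _ _ => rfl
  rw [mem_primesIn, mem_filter, mem_range, Nat.lt_succ_iff]
  tauto

lemma prod_primesIn_dvd_eq {N : ℕ} (hN : 1 ≤ N) (a : ℕ) (f : ℕ → ℝ) :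
    ∀ᶠ z : ℝ in atTop, ∏ p ∈ (primesIn a z).filter (fun p => p ∣ N), f p =
      ∏ p ∈ N.primeFactors.filter (fun p => a ≤ p), f p := by
  filter_upwards [eventually_ge_atTop (N : ℝ)] with z hz
  refine prod_congr (Finset.ext fun p => ?_) fun _ _ => rfl
  rw [mem_filter, mem_filter, mem_primesIn, Nat.mem_primeFactors]
  constructor
  · rintro ⟨⟨⟨h1, h2⟩, h3⟩, h4⟩
    exact ⟨⟨h3, h4, by lia⟩, h1⟩
  · rintro ⟨⟨h1, h2, h3⟩, h4⟩
    exact ⟨⟨⟨h4, (Nat.le_of_dvd hN h2).trans (Nat.le_floor hz)⟩, h1⟩, h2⟩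

lemma prod_one_sub_inv_eq_exp (z : ℝ) :
    ∏ p ∈ primesIn 2 z, (1 - 1 / (p : ℝ)) = Real.exp (-mertensSum ⌊z⌋₊) := by
  rw [mertensSum, sum_neg_distrib, neg_neg, Real.exp_sum, primesIn_two]
  refine prod_congr rfl fun p hp => (Real.exp_log ?_).symm
  have := inv_prime_bounds (Nat.two_le_of_mem_primesLE hp)
  linarith

/-- **Mertens' third theorem**. -/
lemma prod_one_sub_inv_isEquivalent :
    (fun z : ℝ => ∏ p ∈ primesIn 2 z, (1 - 1 / (p : ℝ))) ~[atTop]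
      fun z => 1 / (C₁ * Real.log z) := by
  refine isEquivalent_of_tendsto_one ?_
  have h1 := tendsto_mertensSum_sub_log_log.comp (tendsto_nat_floor_atTop (α := ℝ))
  have h2 : Tendsto (fun z : ℝ => Real.log (Real.log (⌊z⌋₊ : ℝ)) - Real.log (Real.log z)) atTop
      (𝓝 0) := by
    refine (tendsto_log_log_floor_exp_sub_log.comp Real.tendsto_log_atTop).congr' ?_
    filter_upwards [eventually_gt_atTop 0] with z hz
    rw [Function.comp_apply, Real.exp_log hz]
  -- The quotient of the two sides is the exponential of `γ` minus the quantity in Mertens' theorem,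
  -- whose limit is `γ`.
  have h3 := (Real.continuous_exp.tendsto _).comp
    (tendsto_const_nhds (x := Real.eulerMascheroniConstant) |>.sub (h1.add h2))
  rw [add_zero, sub_self, Real.exp_zero] at h3
  refine h3.congr' ?_
  filter_upwards [eventually_gt_atTop 1] with z hz
  have hlog : 0 < Real.log z := Real.log_pos hz
  simp only [Function.comp_apply, Pi.div_apply]
  rw [prod_one_sub_inv_eq_exp, C₁, one_div, div_inv_eq_mul,
    show Real.eulerMascheroniConstant - (mertensSum ⌊z⌋₊ - Real.log (Real.log (⌊z⌋₊ : ℝ)) +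
      (Real.log (Real.log (⌊z⌋₊ : ℝ)) - Real.log (Real.log z))) =
      -mertensSum ⌊z⌋₊ + (Real.eulerMascheroniConstant + Real.log (Real.log z)) by ring,
    Real.exp_add, Real.exp_add, Real.exp_log hlog]

lemma omega_isEquivalent {N : ℕ} (hN : 1 ≤ N) :
    (fun z : ℝ => omega (primeProd z) N) ~[atTop]
      fun z : ℝ => 2 * C₂ * dN N / (C₁ ^ 2 * Real.log z ^ 2) := by
  have h1 := (isEquivalent_const_iff_tendsto multipliable_factor2.2.ne').2
    (tendsto_prod_primesIn multipliable_factor2.1)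
  have h2 := (h1.mul (IsEquivalent.refl (u := fun _ : ℝ => 2 * dN N))).mul
    (prod_one_sub_inv_isEquivalent.pow 2)
  refine (h2.congr_left ?_).congr_right (.of_forall fun z => ?_)
  · filter_upwards [eventually_ge_atTop 2, prod_primesIn_dvd_eq hN 3 fun p =>
      ((p : ℝ) - 1) / ((p : ℝ) - 2)] with z hz hd
    rw [omega_formula N hz, hd, prod_pow]
    simp only [Pi.mul_apply, Pi.pow_apply, dN]
    ring
  · simp only [Pi.mul_apply, Pi.pow_apply, Function.const_apply]
    ring

lemma omegaD_one_isEquivalent {N : ℕ} (hN : 1 ≤ N) :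
    (fun z : ℝ => omegaD 1 (primeProd z) N) ~[atTop]
      fun z : ℝ => 9 * C₃ * dN' N / (2 * C₁ ^ 3 * Real.log z ^ 3) := by
  have h1 := (isEquivalent_const_iff_tendsto multipliable_factor3.2.ne').2
    (tendsto_prod_primesIn multipliable_factor3.1)
  have h2 := (h1.mul (IsEquivalent.refl (u := fun _ : ℝ => 9 / 2 * dN' N))).mul
    (prod_one_sub_inv_isEquivalent.pow 3)
  refine (h2.congr_left ?_).congr_right (.of_forall fun z => ?_)
  · filter_upwards [eventually_ge_atTop 3, prod_primesIn_dvd_eq hN 5 fun p =>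
      ((p : ℝ) - 1) / ((p : ℝ) - 3)] with z hz hd
    rw [omegaD_one_formula N hz, hd, prod_pow]
    simp only [Pi.mul_apply, Pi.pow_apply, dN']
    ring
  · simp only [Pi.mul_apply, Pi.pow_apply, Function.const_apply]
    ring

end Asymptotics

end GoldbachDensity

theorem mainTheorem12 :
    -- the infinite products defining `C₂` and `C₃` converge, to positive limits
    (Multipliable (fun p : {p : ℕ // p.Prime ∧ 3 ≤ p} => GoldbachDensity.factor2 p) ∧
      0 < GoldbachDensity.C₂) ∧
    (Multipliable (fun p : {p : ℕ // p.Prime ∧ 5 ≤ p} => GoldbachDensity.factor3 p) ∧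
      0 < GoldbachDensity.C₃) ∧
    ∀ N : ℕ, 1 ≤ N →
      -- exact formula and asymptotic formula for `ω_P(N)`
      (∀ z : ℝ, 2 ≤ z →
        GoldbachDensity.omega (GoldbachDensity.primeProd z) N =
          2 * (∏ p ∈ GoldbachDensity.primesIn 3 z,
                ((p : ℝ) - 2) * p / ((p : ℝ) - 1) ^ 2) *
            (∏ p ∈ (GoldbachDensity.primesIn 3 z).filter (fun p => p ∣ N),
                ((p : ℝ) - 1) / ((p : ℝ) - 2)) *
            ∏ p ∈ GoldbachDensity.primesIn 2 z, (1 - 1 / (p : ℝ)) ^ 2) ∧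
      ((fun z : ℝ => GoldbachDensity.omega (GoldbachDensity.primeProd z) N) ~[Filter.atTop]
        fun z : ℝ => 2 * GoldbachDensity.C₂ * GoldbachDensity.dN N /
          (GoldbachDensity.C₁ ^ 2 * Real.log z ^ 2)) ∧
      -- exact formula and asymptotic formula for `ω_P^1(N)`
      (∀ z : ℝ, 3 ≤ z →
        GoldbachDensity.omegaD 1 (GoldbachDensity.primeProd z) N =
          9 / 2 * (∏ p ∈ GoldbachDensity.primesIn 5 z,
                ((p : ℝ) - 3) * (p : ℝ) ^ 2 / ((p : ℝ) - 1) ^ 3) *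
            GoldbachDensity.threeFactor N *
            (∏ p ∈ (GoldbachDensity.primesIn 5 z).filter (fun p => p ∣ N),
                ((p : ℝ) - 1) / ((p : ℝ) - 3)) *
            ∏ p ∈ GoldbachDensity.primesIn 2 z, (1 - 1 / (p : ℝ)) ^ 3) ∧
      ((fun z : ℝ => GoldbachDensity.omegaD 1 (GoldbachDensity.primeProd z) N) ~[Filter.atTop]
        fun z : ℝ => 9 * GoldbachDensity.C₃ * GoldbachDensity.dN' N /
          (2 * GoldbachDensity.C₁ ^ 3 * Real.log z ^ 3)) := by
  exact ⟨GoldbachDensity.multipliable_factor2, GoldbachDensity.multipliable_factor3, fun N hN =>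
    ⟨fun z hz => GoldbachDensity.omega_formula N hz, GoldbachDensity.omega_isEquivalent hN,
      fun z hz => GoldbachDensity.omegaD_one_formula N hz,
      GoldbachDensity.omegaD_one_isEquivalent hN⟩⟩
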